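/- Let $\Bbbk$ be an algebraically closed field, let $n\ge 0$ be an integer, and let $\mathcal S=\Bbbk[x_0,\ldots,x_n]=\bigoplus_{d\ge0}\mathcal S_d$ be the polynomial ring with its standard grading. For a homogeneous ideal $I\subseteq\mathcal S$ write $\mathrm{HS}_{\mathcal S/I}(t)=\sum_{d\ge0}\dim_{\Bbbk}(\mathcal S/I)_d\,t^d$ for its Hilbert series, and for a power series $P=\sum_{i\ge0}a_it^i$ write $\mathrm{coeff}_d(P)=a_d$. A property is said to hold for general forms of degrees $d_1,\ldots,d_s$ if it holds for all tuples in some nonempty Zariski-open subset of the affine space $\mathcal S_{d_1}\times\cdots\times\mathcal S_{d_s}$. Let $m_2,\ldots,m_6\ge 0$ be integers such that $$m_2\le n+1\qquad\text{and}\qquad m_2(n+1)+m_3-1\le\binom{n+3}{3}.$$ Then property $\mathrm P_{n,6}(2^{(m_2)},3^{(m_3)},4^{(m_4)},5^{(m_5)},6^{(m_6)})$ holds; that is, if $I\subseteq\mathcal S$ is the ideal generated by general forms, $m_i$ of which have degree $i$ for each $i=2,\ldots,6$, then $$\mathrm{coeff}_6\bigl(\mathrm{HS}_{\mathcal S/I}(t)\bigr)\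 \ge\ \mathrm{coeff}_6\left(\frac{\prod_{i=2}^{6}(1-t^i)^{m_i}}{(1-t)^{n+1}}\right).$$ -/

import Mathlib

noncomputable section

/-- A tuple of forms `(f_i)` in `k[x_0, …, x_n]` with `f_i` homogeneous of degree `deg i`, i.e. a
point of the finite-dimensional `k`-vector space `∏ i, S_{deg i}`. -/
abbrev FormTuple (k : Type*) [Field k] (n : ℕ) {s : ℕ} (deg : Fin s → ℕ) : Type _ :=
  (i : Fin s) → MvPolynomial.homogeneousSubmodule (Fin (n + 1)) k (deg i)

/-- The coordinates of the affine space `∏ i, S_{deg i}`: one for every `i` and every monomial of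
degree `deg i` in `x_0, …, x_n`. -/
abbrev FormCoord (n : ℕ) {s : ℕ} (deg : Fin s → ℕ) : Type :=
  (i : Fin s) × {u : Fin (n + 1) →₀ ℕ // u.degree = deg i}

namespace FormTuple

variable {k : Type*} [Field k] {n s : ℕ} {deg : Fin s → ℕ}

/-- The coordinate vector of a tuple of forms: its coefficients. -/
def coords (f : FormTuple k n deg) (c : FormCoord n deg) : k :=
  MvPolynomial.coeff c.2.1 (f c.1 : MvPolynomial (Fin (n + 1)) k)

/-- Zariski-open subsets of `∏ i, S_{deg i}`: complements of common zero loci of sets of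
polynomials in the coefficients. -/
def IsZariskiOpen (U : Set (FormTuple k n deg)) : Prop :=
  ∃ A : Set (MvPolynomial (FormCoord n deg) k),
    U = {f | ∀ Φ ∈ A, MvPolynomial.eval f.coords Φ = 0}ᶜ

/-- A property holds for general forms of degrees `deg` if it holds for all tuples in some nonempty
Zariski-open subset of `∏ i, S_{deg i}`. -/
def HoldsForGeneral (P : FormTuple k n deg → Prop) : Prop :=
  ∃ U : Set (FormTuple k n deg), IsZariskiOpen U ∧ U.Nonempty ∧ ∀ f ∈ U, P f

/-- The ideal `(f_1, …, f_s)` generated by a tuple of forms. -/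
def ideal (f : FormTuple k n deg) : Ideal (MvPolynomial (Fin (n + 1)) k) :=
  Ideal.span (Set.range fun i => (f i : MvPolynomial (Fin (n + 1)) k))

end FormTuple

/-- `(S/I)_d` as a `k`-subspace of `S/I`, where `S = k[x_0, …, x_n]`: the image of `S_d`. -/
def quotientPiece {k : Type*} [Field k] {n : ℕ} (I : Ideal (MvPolynomial (Fin (n + 1)) k))
    (d : ℕ) : Submodule k (MvPolynomial (Fin (n + 1)) k ⧸ I) :=
  (MvPolynomial.homogeneousSubmodule (Fin (n + 1)) k d).map (Ideal.Quotient.mkₐ k I).toLinearMap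

/-- The Hilbert series `∑ d, dim_k (S/I)_d t^d`. -/
def hilbertSeries {k : Type*} [Field k] {n : ℕ} (I : Ideal (MvPolynomial (Fin (n + 1)) k)) :
    PowerSeries ℤ :=
  PowerSeries.mk fun d => (Module.finrank k (quotientPiece I d) : ℤ)

/-- The power series `∏ i, (1 - t ^ deg i) / (1 - t) ^ (n + 1)`. -/
def expectedSeries (n : ℕ) {s : ℕ} (deg : Fin s → ℕ) : PowerSeries ℤ :=
  (∏ i, (1 - PowerSeries.X ^ deg i)) *
    ((PowerSeries.invOneSubPow ℤ (n + 1) : (PowerSeries ℤ)ˣ) : PowerSeries ℤ)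

/-- The property `P_{n,d}(d_1, …, d_s)` over the field `k`, where `degs` is the list
`(d_1, …, d_s)`: for general forms `f_1, …, f_s` of these degrees in `n + 1` variables, the
coefficient of `t ^ d` in the Hilbert series of `S/(f_1, …, f_s)` is at least the coefficient of
`t ^ d` in `∏ i, (1 - t ^ d_i) / (1 - t) ^ (n + 1)`. -/
def PropertyP (k : Type*) [Field k] (n d : ℕ) (degs : List ℕ) : Prop :=
  FormTuple.HoldsForGeneral (k := k) (n := n) (deg := degs.get) fun f =>
    PowerSeries.coeff d (expectedSeries n degs.get) ≤ PowerSeries.coeff d (hilbertSeries f.ideal)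

/-- The list `(a_1^{(m_1)}, …, a_s^{(m_s)})` in which `a_1` occurs `m_1` times, then `a_2` occurs
`m_2` times, and so on; the argument is the list of the pairs `(a_i, m_i)`. -/
def degreeList (L : List (ℕ × ℕ)) : List ℕ :=
  L.flatMap fun p => List.replicate p.2 p.1

end

/-! Let H(j,d) be the Hilbert function after j forms and E(j,d) the expected coefficient.
Multiplication by the next form, of degree e, gives H(j,d) ≤ H(j+1,d) + H(j,d-e), while E(j+1,d) =
E(j,d) - E(j,d-e). So H(j,6) ≥ E(j,6) passes to j+1 whenever H(j,6-e) ≤ E(j,6-e).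

For quadrics this upper bound is needed in degree 4. It follows from the independence of enough
multiples x^u q_i with deg u ≤ 2; this is an open condition, and q_i = x_i^2 satisfies it since m₂ ≤
n+1 (`holdsForGeneral_linearIndepOn_quadricMultiples`, `hilbert_le_expectedCoeff`). No other
genericity is used.

For cubics H(j,3) may exceed E(j,3). Instead 2H(j,6) - H(j,3)(H(j,3)+1) never decreases, and its
expected analogue is constant. The numerical hypothesis says that E(·,3) is at least -1 after all
cubics, which suffices to compare the degree 6 terms (`expectedCoeff_le_hilbert_cubics`).

For degrees 4 to 6 only degrees 6-e ≤ 2 matter, where just the quadrics contribute to E. -/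

open MvPolynomial Module

/-! ### Hilbert functions of quotients and the effect of one more form -/

section HilbertFunction

variable {k : Type*} [Field k] {n : ℕ}

/-- The exponents of the monomials of degree `d` in `n + 1` variables. -/
noncomputable def expFinset (n d : ℕ) : Finset (Fin (n + 1) →₀ ℕ) :=
  Finset.univ.finsuppAntidiag d

theorem mem_expFinset {d : ℕ} {u : Fin (n + 1) →₀ ℕ} : u ∈ expFinset n d ↔ u.degree = d := by
  simp [expFinset, Finsupp.degree_eq_sum]

theorem card_expFinset (n d : ℕ) : (expFinset n d).card = (n + d).choose n := by
  rw [expFinset, Finset.card_finsuppAntidiag_nat_eq_choose, Finset.card_univ, Fintype.card_fin,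
    show n + 1 + d - 1 = n + d by omega, Nat.choose_symm_add]

instance finite_homogeneousSubmodule (d : ℕ) :
    Module.Finite k (homogeneousSubmodule (Fin (n + 1)) k d) :=
  Module.Finite.iff_fg.2 (homogeneousSubmodule_fg _ _ d)

instance finite_quotientPiece (I : Ideal (MvPolynomial (Fin (n + 1)) k)) (d : ℕ) :
    Module.Finite k (quotientPiece I d) := by
  unfold quotientPiece; infer_instance

theorem linearIndependent_monomial_one :
    LinearIndependent k fun u : Fin (n + 1) →₀ ℕ => (monomial u (1 : k)) := by
  simpa using (basisMonomials (Fin (n + 1)) k).linearIndependent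

theorem finrank_homogeneousSubmodule (d : ℕ) :
    finrank k (homogeneousSubmodule (Fin (n + 1)) k d) = (n + d).choose n := by
  have h : homogeneousSubmodule (Fin (n + 1)) k d =
      Submodule.span k (Set.range fun u : expFinset n d => monomial u.1 (1 : k)) := by
    apply le_antisymm
    · intro p hp
      rw [p.as_sum]
      refine Submodule.sum_mem _ fun u hu => ?_
      rw [← mul_one (coeff u p), ← smul_eq_mul, ← smul_monomial]
      refine Submodule.smul_mem _ _ (Submodule.subset_span ⟨⟨u, ?_⟩, rfl⟩)
      rw [mem_expFinset]
      by_contra hne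
      exact (mem_support_iff.1 hu) (IsHomogeneous.coeff_eq_zero hp hne)
    · rw [Submodule.span_le]
      rintro _ ⟨u, rfl⟩
      exact isHomogeneous_monomial _ (mem_expFinset.1 u.2)
  rw [h, finrank_span_eq_card, Fintype.card_coe, card_expFinset]
  exact linearIndependent_monomial_one.comp _ Subtype.val_injective

/-- The degree `d` piece of an ideal. -/
noncomputable def idealPiece (J : Ideal (MvPolynomial (Fin (n + 1)) k)) (d : ℕ) :
    Submodule k (MvPolynomial (Fin (n + 1)) k) :=
  J.restrictScalars k ⊓ homogeneousSubmodule (Fin (n + 1)) k d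

instance finite_idealPiece (J : Ideal (MvPolynomial (Fin (n + 1)) k)) (d : ℕ) :
    Module.Finite k (idealPiece J d) :=
  Submodule.finiteDimensional_inf_right _ _

theorem finrank_quotientPiece_add (J : Ideal (MvPolynomial (Fin (n + 1)) k)) (d : ℕ) :
    finrank k (quotientPiece J d) + finrank k (idealPiece J d) = (n + d).choose n := by
  rw [← finrank_homogeneousSubmodule (k := k)]
  set A := homogeneousSubmodule (Fin (n + 1)) k d
  rw [← LinearMap.finrank_range_add_finrank_ker
    ((Ideal.Quotient.mkₐ k J).toLinearMap.domRestrict A), LinearMap.range_domRestrict]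
  congr 1
  rw [← Submodule.finrank_map_subtype_eq A, LinearMap.ker_domRestrict,
    Submodule.map_comap_subtype]
  have : idealPiece J d = A ⊓ LinearMap.ker (Ideal.Quotient.mkₐ k J).toLinearMap := by
    ext p
    simp [idealPiece, A, Ideal.Quotient.eq_zero_iff_mem, and_comm]
  rw [this]

theorem finrank_quotientPiece_le (J : Ideal (MvPolynomial (Fin (n + 1)) k)) (d : ℕ) :
    finrank k (quotientPiece J d) ≤ (n + d).choose n := by
  have := finrank_quotientPiece_add J d
  omega

theorem idealPiece_mono {J J' : Ideal (MvPolynomial (Fin (n + 1)) k)} (h : J ≤ J') (d : ℕ) :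
    idealPiece J d ≤ idealPiece J' d :=
  inf_le_inf_right _ h

theorem finrank_quotientPiece_anti {J J' : Ideal (MvPolynomial (Fin (n + 1)) k)} (h : J ≤ J')
    (d : ℕ) : finrank k (quotientPiece J' d) ≤ finrank k (quotientPiece J d) := by
  have h1 := finrank_quotientPiece_add J d
  have h2 := finrank_quotientPiece_add J' d
  have h3 := Submodule.finrank_mono (idealPiece_mono h d)
  omega

theorem mem_of_finrank_quotientPiece_eq {J : Ideal (MvPolynomial (Fin (n + 1)) k)} {d : ℕ}
    {f : MvPolynomial (Fin (n + 1)) k} (hf : f.IsHomogeneous d)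
    (h : finrank k (quotientPiece (J ⊔ Ideal.span {f}) d) = finrank k (quotientPiece J d)) :
    f ∈ J := by
  have h1 := finrank_quotientPiece_add J d
  have h2 := finrank_quotientPiece_add (J ⊔ Ideal.span {f}) d
  have h3 : idealPiece J d = idealPiece (J ⊔ Ideal.span {f}) d :=
    Submodule.eq_of_le_of_finrank_eq (idealPiece_mono le_sup_left d) (by omega)
  have h4 : f ∈ idealPiece (J ⊔ Ideal.span {f}) d :=
    ⟨Ideal.mem_sup_right (Ideal.mem_span_singleton_self f), hf⟩
  rw [← h3] at h4
  exact h4.1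

theorem finrank_quotientPiece_add_card_le {J : Ideal (MvPolynomial (Fin (n + 1)) k)} {d : ℕ}
    {ι : Type*} {v : ι → MvPolynomial (Fin (n + 1)) k} (T : Finset ι)
    (hv : LinearIndepOn k v (T : Set ι)) (hJ : ∀ i ∈ T, v i ∈ J)
    (hd : ∀ i ∈ T, (v i).IsHomogeneous d) :
    finrank k (quotientPiece J d) + T.card ≤ (n + d).choose n := by
  rw [← finrank_quotientPiece_add J d, Nat.add_le_add_iff_left]
  have hw : LinearIndependent k fun i : T => (⟨v i, hJ i i.2, hd i i.2⟩ : idealPiece J d) :=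
    LinearIndependent.of_comp (idealPiece J d).subtype hv
  simpa using hw.fintype_card_le_finrank

attribute [local instance] MvPolynomial.gradedAlgebra

theorem homogeneousComponent_mul_of_isHomogeneous {f : MvPolynomial (Fin (n + 1)) k} {e d : ℕ}
    (hf : f.IsHomogeneous e) (he : e ≤ d) (a : MvPolynomial (Fin (n + 1)) k) :
    homogeneousComponent d (a * f) = homogeneousComponent (d - e) a * f := by
  have := DirectSum.coe_decompose_mul_of_right_mem_of_le
    (homogeneousSubmodule (Fin (n + 1)) k) (a := a) hf he
  rwa [← decomposition.decompose'_apply, ← decomposition.decompose'_apply]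

/-- Adding a form of degree `e` to a homogeneous ideal lowers the Hilbert function in degree `d`
by at most its value in degree `d - e`. -/
theorem finrank_quotientPiece_le_add {J : Ideal (MvPolynomial (Fin (n + 1)) k)}
    (hJ : J.IsHomogeneous (homogeneousSubmodule (Fin (n + 1)) k))
    {f : MvPolynomial (Fin (n + 1)) k} {e d : ℕ} (hf : f.IsHomogeneous e) (he : e ≤ d) :
    finrank k (quotientPiece J d) ≤
      finrank k (quotientPiece (J ⊔ Ideal.span {f}) d) + finrank k (quotientPiece J (d - e)) := by
  set J' := J ⊔ Ideal.span {f}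
  have hle : J ≤ J' := le_sup_left
  let ψ := (Ideal.Quotient.factorₐ k hle).toLinearMap
  have hmap : (quotientPiece J d).map ψ = quotientPiece J' d := by
    rw [quotientPiece, quotientPiece, ← Submodule.map_comp]
    rfl
  rw [← LinearMap.finrank_range_add_finrank_ker (ψ.domRestrict (quotientPiece J d)),
    LinearMap.range_domRestrict, hmap, Nat.add_le_add_iff_left,
    ← Submodule.finrank_map_subtype_eq, LinearMap.ker_domRestrict, Submodule.map_comap_subtype]
  -- The kernel of (S/J)_d → (S/J')_d lies in f · (S/J)_{d-e}: take the degree d component of p = j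
  -- + a f.
  refine le_trans (Submodule.finrank_mono ?_)
    (Submodule.finrank_map_le (LinearMap.mulRight k (Ideal.Quotient.mk J f))
      (quotientPiece J (d - e)))
  rintro _ ⟨⟨p, hp, rfl⟩, hker⟩
  have hpJ : p ∈ J' := Ideal.Quotient.eq_zero_iff_mem.1 hker
  obtain ⟨j, hj, y, hy, hsum⟩ := Submodule.mem_sup.1 hpJ
  obtain ⟨a, rfl⟩ := Ideal.mem_span_singleton'.1 hy
  refine ⟨Ideal.Quotient.mk J (homogeneousComponent (d - e) a),
    ⟨_, homogeneousComponent_mem _ _, rfl⟩, ?_⟩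
  change Ideal.Quotient.mk J _ * Ideal.Quotient.mk J f = Ideal.Quotient.mk J p
  rw [← map_mul, ← homogeneousComponent_mul_of_isHomogeneous hf he]
  symm
  rw [Ideal.Quotient.eq, ← homogeneousComponent_eq_self hp, ← map_sub, ← hsum, add_sub_cancel_right]
  exact homogeneousComponent_mem_of_mem hJ hj d

end HilbertFunction

/-! ### Independence of multiples of general quadrics -/

section GenericIndependence

variable {k : Type*} [Field k] {n s : ℕ} {deg : Fin s → ℕ}

/-- The coefficient of the monomial with exponent `w` in `x ^ u * f i`, as a polynomial in the
coefficients of `f`. -/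
noncomputable def shiftedCoeff (k : Type*) [Field k] (deg : Fin s → ℕ) (i : Fin s)
    (u w : Fin (n + 1) →₀ ℕ) : MvPolynomial (FormCoord n deg) k :=
  if h : u ≤ w ∧ (w - u).degree = deg i then X ⟨i, w - u, h.2⟩ else 0

theorem eval_shiftedCoeff (f : FormTuple k n deg) (i : Fin s) (u w : Fin (n + 1) →₀ ℕ) :
    eval f.coords (shiftedCoeff k deg i u w) =
      coeff w (monomial u 1 * (f i : MvPolynomial (Fin (n + 1)) k)) := by
  rw [coeff_monomial_mul', shiftedCoeff]
  by_cases h1 : u ≤ w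
  · by_cases h2 : (w - u).degree = deg i
    · simp [h1, h2, FormTuple.coords]
    · have : coeff (w - u) (f i : MvPolynomial (Fin (n + 1)) k) = 0 :=
        IsHomogeneous.coeff_eq_zero (f i).2 h2
      simp [h2, this]
  · simp [h1]

/-- If finitely many monomial multiples of the forms of a tuple are pairwise distinct monomials,
then the same multiples of the forms of a general tuple are linearly independent. -/
theorem holdsForGeneral_linearIndependent {τ : Type*} [Fintype τ] (i : τ → Fin s)
    (u w : τ → Fin (n + 1) →₀ ℕ) (hw : Function.Injective w) (f₀ : FormTuple k n deg)
    (h₀ : ∀ t, monomial (u t) 1 * (f₀ (i t) : MvPolynomial (Fin (n + 1)) k) =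
      monomial (w t) 1) :
    FormTuple.HoldsForGeneral fun f : FormTuple k n deg =>
      LinearIndependent k fun t =>
        monomial (u t) 1 * (f (i t) : MvPolynomial (Fin (n + 1)) k) := by
  classical
  -- Row t lists the coefficients of x^(u t) f_(i t) at the monomials w t'. The determinant is
  -- polynomial in the coefficients of f and equals 1 at `f₀`, so its nonvanishing defines the open
  -- set.
  let M : Matrix τ τ (MvPolynomial (FormCoord n deg) k) :=
    .of fun t t' => shiftedCoeff k deg (i t) (u t) (w t')
  have hM (f : FormTuple k n deg) : eval f.coords M.det =
      (Matrix.of fun t t' => coeff (w t')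
        (monomial (u t) 1 * (f (i t) : MvPolynomial (Fin (n + 1)) k))).det := by
    rw [RingHom.map_det]
    congr 1
    ext t t'
    exact eval_shiftedCoeff f _ _ _
  refine ⟨{f | ∀ Φ ∈ ({M.det} : Set _), eval f.coords Φ = 0}ᶜ, ⟨_, rfl⟩, ⟨f₀, ?_⟩, ?_⟩
  · have : (Matrix.of fun t t' => coeff (w t')
        (monomial (u t) 1 * (f₀ (i t) : MvPolynomial (Fin (n + 1)) k))) = 1 := by
      ext t t'
      rw [Matrix.of_apply, h₀, coeff_monomial, Matrix.one_apply]
      simp [hw.eq_iff]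
    simp [hM, this]
  · intro f hf
    have hdet : eval f.coords M.det ≠ 0 := by simpa using hf
    rw [hM] at hdet
    exact LinearIndependent.of_comp (LinearMap.pi fun t' => lcoeff k (w t'))
      (Matrix.linearIndependent_rows_of_det_ne_zero hdet)

theorem FormTuple.HoldsForGeneral.mono {P Q : FormTuple k n deg → Prop}
    (h : FormTuple.HoldsForGeneral P) (hPQ : ∀ f, P f → Q f) : FormTuple.HoldsForGeneral Q :=
  let ⟨U, hU, hne, hP⟩ := h
  ⟨U, hU, hne, fun f hf => hPQ f (hP f hf)⟩

/-- The pairs `(i, u)` with `i < m` and `u` of degree at most two, `u` not being the exponent of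
the square of a variable `x_l` with `l < i`. If `q_i` is replaced by `x_i ^ 2`, then the products
`x ^ u * q_i` are pairwise distinct monomials. -/
def quadricMultiples (n m : ℕ) : Set (Σ _ : Fin (n + 1), Fin (n + 1) →₀ ℕ) :=
  {p | p.1.1 < m ∧ p.2.degree ≤ 2 ∧ ∀ l < p.1, p.2 ≠ Finsupp.single l 2}

theorem finite_quadricMultiples (n m : ℕ) : (quadricMultiples n m).Finite :=
  (Finset.finite_toSet (Finset.univ.sigma fun _ : Fin (n + 1) =>
    (Finsupp.finite_of_degree_le (σ := Fin (n + 1)) 2).toFinset)).subset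
      fun p hp => by simpa using hp.2.1

theorem eq_single_of_le_of_degree_le {σ : Type*} {u : σ →₀ ℕ} {a : σ} {d : ℕ} (h : d ≤ u a)
    (hu : u.degree ≤ d) : u = Finsupp.single a d := by
  have hle : Finsupp.single a d ≤ u := Finsupp.single_le_iff.2 h
  have hadd := tsub_add_cancel_of_le hle
  have hdeg := congrArg Finsupp.degree hadd
  rw [map_add, Finsupp.degree_single] at hdeg
  have h0 : u - Finsupp.single a d = 0 := (Finsupp.degree_eq_zero_iff _).1 (by omega)
  rw [← hadd, h0, zero_add]

/-- If x^u x_i^2 = x^v x_j^2 with i < j, then x_i^2 divides x^v; as deg v ≤ 2, v is the exponent of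
x_i^2, which is excluded. -/
theorem injOn_quadricMultiples (n m : ℕ) :
    Set.InjOn (fun p : Σ _ : Fin (n + 1), Fin (n + 1) →₀ ℕ => p.2 + Finsupp.single p.1 2)
      (quadricMultiples n m) := by
  have key : ∀ p ∈ quadricMultiples n m, ∀ q ∈ quadricMultiples n m,
      p.2 + Finsupp.single p.1 2 = q.2 + Finsupp.single q.1 2 → ¬ p.1 < q.1 := by
    intro p _ q hq h hlt
    have h1 := DFunLike.congr_fun h p.1
    simp only [Finsupp.add_apply, Finsupp.single_eq_same, Finsupp.single_apply, hlt.ne',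
      if_false] at h1
    exact hq.2.2 p.1 hlt (eq_single_of_le_of_degree_le (by omega) hq.2.1)
  rintro ⟨i, u⟩ hp ⟨j, v⟩ hq h
  have hij : i = j := le_antisymm (not_lt.1 (key _ hq _ hp h.symm)) (not_lt.1 (key _ hp _ hq h))
  subst hij
  simpa using h

/-- The members of `quadricMultiples n m` with first component below `j` and second component of
degree `d`. -/
noncomputable def quadricMultiplesFinset (n j d : ℕ) :
    Finset (Σ _ : Fin (n + 1), Fin (n + 1) →₀ ℕ) :=
  (Finset.univ.filter fun i : Fin (n + 1) => i.1 < j).sigma fun i =>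
    (expFinset n d).filter fun u => ∀ l < i, u ≠ Finsupp.single l 2

theorem coe_quadricMultiplesFinset_subset {n j m d : ℕ} (hj : j ≤ m) (hd : d ≤ 2) :
    (quadricMultiplesFinset n j d : Set _) ⊆ quadricMultiples n m := by
  intro p hp
  simp only [quadricMultiplesFinset, Finset.coe_sigma, Set.mem_sigma_iff, Finset.mem_coe,
    Finset.mem_filter, Finset.mem_univ, true_and, mem_expFinset] at hp
  exact ⟨by omega, by omega, hp.2.2⟩

theorem card_filter_expFinset_of_lt {d : ℕ} (hd : d < 2) (i : Fin (n + 1)) :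
    ((expFinset n d).filter fun u => ∀ l < i, u ≠ Finsupp.single l 2).card = (n + d).choose n := by
  rw [Finset.filter_true_of_mem, card_expFinset]
  rintro u hu l - rfl
  rw [mem_expFinset, Finsupp.degree_single] at hu
  omega

theorem le_card_filter_expFinset (i : Fin (n + 1)) :
    (n + 2).choose n ≤
      ((expFinset n 2).filter fun u => ∀ l < i, u ≠ Finsupp.single l 2).card + i := by
  have h : expFinset n 2 ⊆ (expFinset n 2).filter (fun u => ∀ l < i, u ≠ Finsupp.single l 2) ∪
      (Finset.Iio i).image fun l => Finsupp.single l 2 := by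
    intro u hu
    by_cases h : ∀ l < i, u ≠ Finsupp.single l 2
    · exact Finset.mem_union_left _ (Finset.mem_filter.2 ⟨hu, h⟩)
    · push Not at h
      obtain ⟨l, hl, rfl⟩ := h
      exact Finset.mem_union_right _ (Finset.mem_image_of_mem _ (Finset.mem_Iio.2 hl))
  have h1 := (Finset.card_le_card h).trans (Finset.card_union_le _ _)
  have h2 := (Finset.card_image_le (s := Finset.Iio i)
    (f := fun l => (Finsupp.single l 2 : Fin (n + 1) →₀ ℕ)))
  rw [Fin.card_Iio] at h2
  rw [card_expFinset] at h1
  omega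

theorem card_quadricMultiplesFinset_succ {j : ℕ} (hj : j < n + 1) (d : ℕ) :
    (quadricMultiplesFinset n (j + 1) d).card = (quadricMultiplesFinset n j d).card +
      ((expFinset n d).filter fun u => ∀ l < (⟨j, hj⟩ : Fin (n + 1)),
        u ≠ Finsupp.single l 2).card := by
  rw [quadricMultiplesFinset, quadricMultiplesFinset, Finset.card_sigma, Finset.card_sigma,
    show (Finset.univ.filter fun i : Fin (n + 1) => i.1 < j + 1) =
      insert ⟨j, hj⟩ (Finset.univ.filter fun i : Fin (n + 1) => i.1 < j) by
        ext i
        simp [Fin.ext_iff]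
        omega,
    Finset.sum_insert (by simp), add_comm]

end GenericIndependence

/-! ### Recursion for the expected coefficients -/

section ExpectedCoeff

/-- The coefficient of `t ^ d` in `∏ i < j, (1 - t ^ D i) / (1 - t) ^ (n + 1)`. -/
noncomputable def expectedCoeff (n : ℕ) (D : ℕ → ℕ) (j d : ℕ) : ℤ :=
  PowerSeries.coeff d ((∏ i ∈ Finset.range j, (1 - PowerSeries.X ^ D i)) *
    ((PowerSeries.invOneSubPow ℤ (n + 1) : (PowerSeries ℤ)ˣ) : PowerSeries ℤ))

variable {n : ℕ} {D : ℕ → ℕ}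

theorem expectedCoeff_zero (d : ℕ) : expectedCoeff n D 0 d = (n + d).choose n := by
  simp [expectedCoeff, PowerSeries.invOneSubPow_val_succ_eq_mk_add_choose]

theorem expectedCoeff_succ (j d : ℕ) : expectedCoeff n D (j + 1) d =
    expectedCoeff n D j d - if D j ≤ d then expectedCoeff n D j (d - D j) else 0 := by
  rw [expectedCoeff, Finset.prod_range_succ, mul_right_comm, mul_sub, mul_one, map_sub,
    PowerSeries.coeff_mul_X_pow']
  rfl

theorem expectedCoeff_succ_of_le {j d : ℕ} (h : D j ≤ d) :
    expectedCoeff n D (j + 1) d = expectedCoeff n D j d - expectedCoeff n D j (d - D j) := by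
  rw [expectedCoeff_succ, if_pos h]

theorem expectedCoeff_succ_of_lt {j d : ℕ} (h : d < D j) :
    expectedCoeff n D (j + 1) d = expectedCoeff n D j d := by
  rw [expectedCoeff_succ, if_neg h.not_ge, sub_zero]

theorem expectedCoeff_eq_of_forall_lt {i j d : ℕ} (hij : i ≤ j)
    (h : ∀ l, i ≤ l → l < j → d < D l) : expectedCoeff n D j d = expectedCoeff n D i d := by
  induction j, hij using Nat.le_induction with
  | base => rfl
  | succ j hij ih =>
    rw [expectedCoeff_succ_of_lt (h j hij j.lt_succ_self),
      ih fun l h1 h2 => h l h1 (h2.trans j.lt_succ_self)]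

theorem expectedSeries_coeff_eq {s : ℕ} {deg : Fin s → ℕ} (hD : ∀ i : Fin s, deg i = D i)
    (d : ℕ) : PowerSeries.coeff d (expectedSeries n deg) = expectedCoeff n D s d := by
  simp only [expectedSeries, expectedCoeff, hD,
    Fin.prod_univ_eq_prod_range (fun i => (1 - PowerSeries.X ^ D i : PowerSeries ℤ)) s]

theorem expectedCoeff_quadrics {j m : ℕ} (hj : j ≤ m) (hD : ∀ i < m, D i = 2) :
    expectedCoeff n D j 0 = 1 ∧ expectedCoeff n D j 1 = n + 1 ∧
      expectedCoeff n D j 2 = (n + 2).choose n - j ∧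
      expectedCoeff n D j 3 = (n + 3).choose n - j * (n + 1) := by
  induction j with
  | zero => simp [expectedCoeff_zero]
  | succ j ih =>
    obtain ⟨h0, h1, h2, h3⟩ := ih (by omega)
    have hj2 := hD j (by omega)
    rw [expectedCoeff_succ_of_lt (by omega), expectedCoeff_succ_of_lt (by omega),
      expectedCoeff_succ_of_le (by omega), expectedCoeff_succ_of_le (by omega), hj2]
    simp only [Nat.sub_self, Nat.reduceSub, h0, h1, h2, h3, true_and]
    push_cast
    constructor <;> ring

/-- The (j+1)-st quadric lowers the expected coefficient by E(j,d) and contributes at least E(j,d)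
new multiples: for d = 2, at most j squares are excluded and E(j,2) = C(n+2,n) - j. -/
theorem le_expectedCoeff_quadrics {j m d : ℕ} (hj : j ≤ m) (hm : m ≤ n + 1)
    (hD : ∀ i < m, D i = 2) (hd : d ≤ 2) :
    ((n + (d + 2)).choose n : ℤ) ≤
      expectedCoeff n D j (d + 2) + (quadricMultiplesFinset n j d).card := by
  induction j with
  | zero => simp [expectedCoeff_zero]
  | succ j ih =>
    have hjn : j < n + 1 := by omega
    have := ih (by omega)
    have hj2 := hD j (by omega)
    rw [expectedCoeff_succ_of_le (by omega), hj2, Nat.add_sub_cancel,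
      card_quadricMultiplesFinset_succ hjn]
    obtain ⟨h0, h1, h2, -⟩ := expectedCoeff_quadrics (n := n) (Nat.le_of_succ_le hj) hD
    push_cast
    interval_cases d
    · rw [card_filter_expFinset_of_lt (by norm_num), h0]
      simp at this ⊢
      linarith
    · rw [card_filter_expFinset_of_lt (by norm_num), h1]
      simp at this ⊢
      linarith
    · have hle := le_card_filter_expFinset (⟨j, hjn⟩ : Fin (n + 1))
      rw [h2]
      have : ((n + 2).choose n : ℤ) ≤ (((expFinset n 2).filter fun u =>
        ∀ l < (⟨j, hjn⟩ : Fin (n + 1)), u ≠ Finsupp.single l 2).card : ℤ) + j := by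
          exact_mod_cast hle
      linarith

end ExpectedCoeff

/-! ### Adding the forms one at a time -/

section Stages

variable {k : Type*} [Field k] {n : ℕ} {D : ℕ → ℕ} {F : ℕ → MvPolynomial (Fin (n + 1)) k}

/-- The ideal generated by the first `j` members of a sequence of polynomials. -/
noncomputable def initialIdeal (F : ℕ → MvPolynomial (Fin (n + 1)) k) (j : ℕ) :
    Ideal (MvPolynomial (Fin (n + 1)) k) :=
  Ideal.span (F '' Set.Iio j)

theorem initialIdeal_zero : initialIdeal F 0 = ⊥ := by
  simp [initialIdeal]

theorem initialIdeal_succ (j : ℕ) :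
    initialIdeal F (j + 1) = initialIdeal F j ⊔ Ideal.span {F j} := by
  have h : Set.Iio (j + 1) = Set.Iio j ∪ {j} := by
    ext i
    simp only [Set.mem_Iio, Set.mem_union, Set.mem_singleton_iff]
    omega
  rw [initialIdeal, initialIdeal, h, Set.image_union, Set.image_singleton, Ideal.span_union]

theorem initialIdeal_mono {i j : ℕ} (h : i ≤ j) : initialIdeal F i ≤ initialIdeal F j :=
  Ideal.span_mono (Set.image_mono (Set.Iio_subset_Iio h))

attribute [local instance] MvPolynomial.gradedAlgebra

theorem isHomogeneous_initialIdeal (hF : ∀ i, (F i).IsHomogeneous (D i)) (j : ℕ) :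
    (initialIdeal F j).IsHomogeneous (homogeneousSubmodule (Fin (n + 1)) k) := by
  apply Ideal.homogeneous_span
  rintro _ ⟨i, -, rfl⟩
  exact ⟨D i, hF i⟩

theorem hilbert_le_hilbert_succ_add (hF : ∀ i, (F i).IsHomogeneous (D i)) {j d : ℕ}
    (hj : D j ≤ d) : (finrank k (quotientPiece (initialIdeal F j) d) : ℤ) ≤
      finrank k (quotientPiece (initialIdeal F (j + 1)) d) +
        finrank k (quotientPiece (initialIdeal F j) (d - D j)) := by
  rw [initialIdeal_succ]
  exact_mod_cast finrank_quotientPiece_le_add (isHomogeneous_initialIdeal hF j) (hF j) hj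

theorem hilbert_anti {i j : ℕ} (h : i ≤ j) (d : ℕ) :
    (finrank k (quotientPiece (initialIdeal F j) d) : ℤ) ≤
      finrank k (quotientPiece (initialIdeal F i) d) := by
  exact_mod_cast finrank_quotientPiece_anti (initialIdeal_mono h) d

theorem hilbert_initialIdeal_zero (d : ℕ) :
    (finrank k (quotientPiece (initialIdeal F 0) d) : ℤ) = (n + d).choose n := by
  rw [← finrank_quotientPiece_add (initialIdeal F 0) d, initialIdeal_zero]
  rw [idealPiece, Submodule.restrictScalars_bot, bot_inf_eq, finrank_bot, add_zero]

variable {m₂ m₃ s : ℕ}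

/-- The independent multiples lie in the ideal, so their number bounds its dimension from below. -/
theorem hilbert_le_expectedCoeff (hF : ∀ i, (F i).IsHomogeneous (D i)) (hm : m₂ ≤ n + 1)
    (hD₂ : ∀ i < m₂, D i = 2)
    (hli : LinearIndepOn k (fun p : Σ _ : Fin (n + 1), Fin (n + 1) →₀ ℕ =>
      monomial p.2 1 * F p.1) (quadricMultiples n m₂))
    {j d : ℕ} (hj : j ≤ m₂) (hd : d ≤ 4) :
    (finrank k (quotientPiece (initialIdeal F j) d) : ℤ) ≤ expectedCoeff n D j d := by
  rcases lt_or_ge d 2 with hd2 | hd2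
  · rw [expectedCoeff_eq_of_forall_lt (Nat.zero_le j)
      fun l _ hl => by rw [hD₂ l (by omega)]; omega, expectedCoeff_zero]
    exact_mod_cast finrank_quotientPiece_le _ _
  · obtain ⟨d, rfl⟩ := Nat.exists_eq_add_of_le' hd2
    have h1 := le_expectedCoeff_quadrics hj hm hD₂ (d := d) (by omega)
    have hmem : ∀ p ∈ quadricMultiplesFinset n j d, p.1.1 < j ∧ p.2.degree = d := fun p hp => by
      simp only [quadricMultiplesFinset, Finset.mem_sigma, Finset.mem_filter, Finset.mem_univ,
        true_and, mem_expFinset] at hp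
      exact ⟨hp.1, hp.2.1⟩
    have h2 := finrank_quotientPiece_add_card_le (J := initialIdeal F j) (d := d + 2)
      (quadricMultiplesFinset n j d)
      (hli.mono (coe_quadricMultiplesFinset_subset hj (by omega)))
      (fun p hp => Ideal.mul_mem_left _ _
        (Ideal.subset_span (Set.mem_image_of_mem F (hmem p hp).1)))
      (fun p hp => by
        obtain ⟨hp1, hp2⟩ := hmem p hp
        have := (isHomogeneous_monomial (1 : k) hp2).mul (hF p.1)
        rwa [hD₂ _ (by omega)] at this)
    have h3 : (finrank k (quotientPiece (initialIdeal F j) (d + 2)) : ℤ) +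
        (quadricMultiplesFinset n j d).card ≤ (n + (d + 2)).choose n := by exact_mod_cast h2
    linarith

theorem expectedCoeff_le_hilbert_quadrics (hF : ∀ i, (F i).IsHomogeneous (D i))
    (hm : m₂ ≤ n + 1) (hD₂ : ∀ i < m₂, D i = 2)
    (hli : LinearIndepOn k (fun p : Σ _ : Fin (n + 1), Fin (n + 1) →₀ ℕ =>
      monomial p.2 1 * F p.1) (quadricMultiples n m₂))
    {d : ℕ} (hd2 : 2 ≤ d) (hd6 : d ≤ 6) {j : ℕ} (hj : j ≤ m₂) :
    expectedCoeff n D j d ≤ finrank k (quotientPiece (initialIdeal F j) d) := by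
  induction j with
  | zero => rw [hilbert_initialIdeal_zero, expectedCoeff_zero]
  | succ j ih =>
    have hj2 := hD₂ j (by omega)
    have h1 := hilbert_le_hilbert_succ_add hF (j := j) (d := d) (by omega)
    have h2 := hilbert_le_expectedCoeff hF hm hD₂ hli (j := j) (d := d - D j) (by omega)
      (by omega)
    rw [expectedCoeff_succ_of_le (by omega)]
    linarith [ih (by omega)]

theorem expectedCoeff_le_hilbert_cubics (hF : ∀ i, (F i).IsHomogeneous (D i))
    (hm : m₂ ≤ n + 1) (hD₂ : ∀ i < m₂, D i = 2) (hD₃ : ∀ i, m₂ ≤ i → i < m₂ + m₃ → D i = 3)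
    (hli : LinearIndepOn k (fun p : Σ _ : Fin (n + 1), Fin (n + 1) →₀ ℕ =>
      monomial p.2 1 * F p.1) (quadricMultiples n m₂))
    (hm₃ : (m₃ : ℤ) ≤ expectedCoeff n D m₂ 3 + 1) :
    expectedCoeff n D (m₂ + m₃) 6 ≤
      finrank k (quotientPiece (initialIdeal F (m₂ + m₃)) 6) := by
  -- The third clause compares 2E₆ - E₃(E₃+1) with 2H₆ - H₃(H₃+1). On the expected side each cubic
  -- lowers E₃ by 1 and E₆ by E₃, leaving the quantity unchanged.
  have hind : ∀ r ≤ m₃,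
      expectedCoeff n D (m₂ + r) 3 = expectedCoeff n D m₂ 3 - r ∧
      expectedCoeff n D (m₂ + r) 3 ≤ finrank k (quotientPiece (initialIdeal F (m₂ + r)) 3) ∧
      2 * expectedCoeff n D (m₂ + r) 6 -
          expectedCoeff n D (m₂ + r) 3 * (expectedCoeff n D (m₂ + r) 3 + 1) ≤
        2 * finrank k (quotientPiece (initialIdeal F (m₂ + r)) 6) -
          finrank k (quotientPiece (initialIdeal F (m₂ + r)) 3) *
            (finrank k (quotientPiece (initialIdeal F (m₂ + r)) 3) + 1 : ℤ) := by
    intro r hr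
    induction r with
    | zero =>
      have h6 := expectedCoeff_le_hilbert_quadrics hF hm hD₂ hli (d := 6) (by norm_num) le_rfl
        (le_refl m₂)
      have h3 := le_antisymm
        (expectedCoeff_le_hilbert_quadrics hF hm hD₂ hli (d := 3) (by norm_num) (by norm_num)
          (le_refl m₂))
        (hilbert_le_expectedCoeff hF hm hD₂ hli (le_refl m₂) (by norm_num))
      rw [Nat.add_zero, Nat.cast_zero, sub_zero]
      refine ⟨rfl, h3.le, ?_⟩
      rw [h3]
      linarith
    | succ r ih =>
      obtain ⟨i1, i2, i3⟩ := ih (by omega)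
      have hj := hD₃ (m₂ + r) (by omega) (by omega)
      have e3 : expectedCoeff n D (m₂ + r + 1) 3 = expectedCoeff n D (m₂ + r) 3 - 1 := by
        rw [expectedCoeff_succ_of_le (by omega), hj, Nat.sub_self,
          expectedCoeff_eq_of_forall_lt (Nat.zero_le _) (d := 0), expectedCoeff_zero]
        · simp
        · intro l _ hl
          rcases lt_or_ge l m₂ with h | h
          · rw [hD₂ l h]; norm_num
          · rw [hD₃ l h (by omega)]; norm_num
      have e6 : expectedCoeff n D (m₂ + r + 1) 6 =
          expectedCoeff n D (m₂ + r) 6 - expectedCoeff n D (m₂ + r) 3 := by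
        rw [expectedCoeff_succ_of_le (by omega), hj]
      have s6 := hilbert_le_hilbert_succ_add hF (j := m₂ + r) (d := 6) (by omega)
      have s3 := hilbert_le_hilbert_succ_add hF (j := m₂ + r) (d := 3) (by omega)
      have s0 := finrank_quotientPiece_le (initialIdeal F (m₂ + r)) 0
      have a3 := hilbert_anti (F := F) (Nat.le_add_right (m₂ + r) 1) 3
      rw [hj] at s6 s3
      simp only [Nat.reduceSub, add_zero, Nat.choose_self] at s6 s3 s0
      rw [← add_assoc, e3, e6, i1]
      rw [i1] at i2 i3
      -- Either the cubic already lies in the ideal and H is unchanged, or H₃ drops by exactly 1 and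
      -- H₆ by at most the old H₃.
      rcases eq_or_ne (finrank k (quotientPiece (initialIdeal F (m₂ + r + 1)) 3))
        (finrank k (quotientPiece (initialIdeal F (m₂ + r)) 3)) with heq | hne
      · have hmem : F (m₂ + r) ∈ initialIdeal F (m₂ + r) := by
          refine mem_of_finrank_quotientPiece_eq (d := 3) (hj ▸ hF (m₂ + r)) ?_
          rw [← initialIdeal_succ, heq]
        have hJ : initialIdeal F (m₂ + r + 1) = initialIdeal F (m₂ + r) := by
          rw [initialIdeal_succ, sup_eq_left, Ideal.span_singleton_le_iff_mem]
          exact hmem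
        rw [hJ]
        push_cast
        refine ⟨by ring, by linarith, by linarith⟩
      · have h3 : (finrank k (quotientPiece (initialIdeal F (m₂ + r)) 3) : ℤ) =
            finrank k (quotientPiece (initialIdeal F (m₂ + r + 1)) 3) + 1 := by omega
        rw [h3] at i2 i3 s6
        push_cast
        refine ⟨by ring, by linarith, by linarith⟩
  obtain ⟨h1, h2, h3⟩ := hind m₃ le_rfl
  have h4 : -1 ≤ expectedCoeff n D (m₂ + m₃) 3 := by linarith
  -- The difference is (H₃ - E₃)(H₃ + E₃ + 1), with both factors nonnegative because H₃ ≥ E₃, H₃ ≥ 0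
  -- and E₃ ≥ -1.
  have h5 : expectedCoeff n D (m₂ + m₃) 3 * (expectedCoeff n D (m₂ + m₃) 3 + 1) ≤
      finrank k (quotientPiece (initialIdeal F (m₂ + m₃)) 3) *
        (finrank k (quotientPiece (initialIdeal F (m₂ + m₃)) 3) + 1 : ℤ) := by
    have h0 : (0 : ℤ) ≤ finrank k (quotientPiece (initialIdeal F (m₂ + m₃)) 3) :=
      Int.natCast_nonneg _
    nlinarith
  linarith

theorem expectedCoeff_le_hilbert (hF : ∀ i, (F i).IsHomogeneous (D i))
    (hm : m₂ ≤ n + 1) (hD₂ : ∀ i < m₂, D i = 2) (hD₃ : ∀ i, m₂ ≤ i → i < m₂ + m₃ → D i = 3)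
    (hD₄ : ∀ i, m₂ + m₃ ≤ i → i < s → 4 ≤ D i ∧ D i ≤ 6)
    (hli : LinearIndepOn k (fun p : Σ _ : Fin (n + 1), Fin (n + 1) →₀ ℕ =>
      monomial p.2 1 * F p.1) (quadricMultiples n m₂))
    (hm₃ : (m₃ : ℤ) ≤ expectedCoeff n D m₂ 3 + 1) {j : ℕ} (hj : m₂ + m₃ ≤ j) (hjs : j ≤ s) :
    expectedCoeff n D j 6 ≤ finrank k (quotientPiece (initialIdeal F j) 6) := by
  induction j, hj using Nat.le_induction with
  | base => exact expectedCoeff_le_hilbert_cubics hF hm hD₂ hD₃ hli hm₃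
  | succ j hj ih =>
    obtain ⟨h4, h6⟩ := hD₄ j hj (by omega)
    have h1 := hilbert_le_hilbert_succ_add hF (j := j) (d := 6) h6
    have h2 := hilbert_anti (F := F) (show m₂ ≤ j by omega) (6 - D j)
    have h3 := hilbert_le_expectedCoeff hF hm hD₂ hli (le_refl m₂) (d := 6 - D j) (by omega)
    -- The forms after the quadrics have degree at least 3, above 6 - D j ≤ 2.
    have h5 : expectedCoeff n D j (6 - D j) = expectedCoeff n D m₂ (6 - D j) := by
      refine expectedCoeff_eq_of_forall_lt (by omega) fun l hl1 hl2 => ?_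
      rcases lt_or_ge l (m₂ + m₃) with h | h
      · rw [hD₃ l hl1 h]; omega
      · have := hD₄ l h (by omega)
        omega
    rw [expectedCoeff_succ_of_le h6]
    linarith [ih (by omega)]

end Stages

/-! ### From sequences back to general tuples -/

section GeneralForms

variable {k : Type*} [Field k] {n s : ℕ} {deg : Fin s → ℕ}

/-- A tuple of forms, continued by zero to a sequence of polynomials. -/
noncomputable def FormTuple.toSeq (f : FormTuple k n deg) (i : ℕ) : MvPolynomial (Fin (n + 1)) k :=
  if h : i < s then f ⟨i, h⟩ else 0

theorem FormTuple.toSeq_val (f : FormTuple k n deg) (i : Fin s) : f.toSeq i = f i := by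
  simp [FormTuple.toSeq]

theorem FormTuple.isHomogeneous_toSeq {D : ℕ → ℕ} (hD : ∀ i : Fin s, deg i = D i)
    (f : FormTuple k n deg) (i : ℕ) : (f.toSeq i).IsHomogeneous (D i) := by
  by_cases h : i < s
  · rw [FormTuple.toSeq, dif_pos h, ← hD ⟨i, h⟩]
    exact (f ⟨i, h⟩).2
  · rw [FormTuple.toSeq, dif_neg h]
    exact isHomogeneous_zero _ _ _

theorem FormTuple.initialIdeal_toSeq (f : FormTuple k n deg) :
    initialIdeal f.toSeq s = f.ideal := by
  rw [initialIdeal, FormTuple.ideal]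
  congr 1
  ext p
  constructor
  · rintro ⟨i, hi, rfl⟩
    exact ⟨⟨i, hi⟩, (f.toSeq_val ⟨i, hi⟩).symm⟩
  · rintro ⟨i, rfl⟩
    exact ⟨i, i.2, f.toSeq_val i⟩

/-- The tuple with the square of the `i`-th variable at each position `i` of degree two. -/
noncomputable def squareTuple (k : Type*) [Field k] (n : ℕ) (deg : Fin s → ℕ) :
    FormTuple k n deg := fun i =>
  if h : deg i = 2 ∧ i.1 < n + 1 then
    ⟨monomial (Finsupp.single ⟨i, h.2⟩ 2) 1,
      isHomogeneous_monomial _ (by rw [Finsupp.degree_single, h.1])⟩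
  else 0

theorem holdsForGeneral_linearIndepOn_quadricMultiples {m : ℕ} (hms : m ≤ s)
    (hdeg : ∀ i : Fin s, i.1 < m → deg i = 2) :
    FormTuple.HoldsForGeneral fun f : FormTuple k n deg =>
      LinearIndepOn k (fun p : Σ _ : Fin (n + 1), Fin (n + 1) →₀ ℕ =>
        monomial p.2 1 * f.toSeq p.1) (quadricMultiples n m) := by
  have := (finite_quadricMultiples n m).fintype
  have hlt (p : quadricMultiples n m) : p.1.1.1 < s := p.2.1.trans_le hms
  refine (holdsForGeneral_linearIndependent (fun p : quadricMultiples n m => ⟨p.1.1.1, hlt p⟩)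
    (fun p => p.1.2) (fun p => p.1.2 + Finsupp.single p.1.1 2)
    (injOn_quadricMultiples n m).injective (squareTuple k n deg) fun p => ?_).mono
      fun f hf => ?_
  · rw [squareTuple, dif_pos ⟨hdeg _ p.2.1, p.1.1.2⟩]
    simp [monomial_mul]
  · rw [LinearIndepOn]
    convert hf using 3 with p
    exact f.toSeq_val ⟨p.1.1.1, hlt p⟩

theorem holdsForGeneral_coeff_six_le (D : ℕ → ℕ) (hD : ∀ i : Fin s, deg i = D i) {m₂ m₃ : ℕ}
    (hs : m₂ + m₃ ≤ s) (hm : m₂ ≤ n + 1) (hD₂ : ∀ i < m₂, D i = 2)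
    (hD₃ : ∀ i, m₂ ≤ i → i < m₂ + m₃ → D i = 3)
    (hD₄ : ∀ i, m₂ + m₃ ≤ i → i < s → 4 ≤ D i ∧ D i ≤ 6)
    (hm₃ : (m₂ : ℤ) * (n + 1) + m₃ - 1 ≤ (n + 3).choose 3) :
    FormTuple.HoldsForGeneral fun f : FormTuple k n deg =>
      PowerSeries.coeff 6 (expectedSeries n deg) ≤
        PowerSeries.coeff 6 (hilbertSeries f.ideal) := by
  refine (holdsForGeneral_linearIndepOn_quadricMultiples (m := m₂) (by omega)
    fun i hi => (hD i).trans (hD₂ i hi)).mono fun f hf => ?_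
  have h3 := (expectedCoeff_quadrics (n := n) (le_refl m₂) hD₂).2.2.2
  have hchoose : (n + 3).choose n = (n + 3).choose 3 := Nat.choose_symm_add
  rw [hchoose] at h3
  rw [expectedSeries_coeff_eq hD, hilbertSeries, PowerSeries.coeff_mk, ← f.initialIdeal_toSeq]
  exact expectedCoeff_le_hilbert (f.isHomogeneous_toSeq hD) hm hD₂ hD₃ hD₄ hf (by linarith) hs
    le_rfl

end GeneralForms

theorem proposition5p8 (k : Type*) [Field k] [IsAlgClosed k] (n m₂ m₃ m₄ m₅ m₆ : ℕ)
    (h₁ : m₂ ≤ n + 1)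
    (h₂ : (m₂ : ℤ) * ((n : ℤ) + 1) + (m₃ : ℤ) - 1 ≤ ((n + 3).choose 3 : ℤ)) :
    PropertyP k n 6 (degreeList [(2, m₂), (3, m₃), (4, m₄), (5, m₅), (6, m₆)]) := by
  have hlist : degreeList [(2, m₂), (3, m₃), (4, m₄), (5, m₅), (6, m₆)] =
      List.replicate m₂ 2 ++ (List.replicate m₃ 3 ++ (List.replicate m₄ 4 ++
        (List.replicate m₅ 5 ++ List.replicate m₆ 6))) := by
    simp [degreeList]
  rw [hlist]
  -- The default `0` only gives degrees past the end of the list, where the sequence of forms is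
  -- zero and hence homogeneous of any degree.
  refine holdsForGeneral_coeff_six_le (fun i => (List.replicate m₂ 2 ++ (List.replicate m₃ 3 ++
    (List.replicate m₄ 4 ++ (List.replicate m₅ 5 ++ List.replicate m₆ 6)))).getD i 0)
    (fun i => by rw [List.getD_eq_getElem _ _ i.2, List.get_eq_getElem]) (by simp) h₁
    (fun i hi => ?_) (fun i hi1 hi2 => ?_) (fun i hi1 hi2 => ?_) h₂
  · rw [List.getD_append _ _ _ _ (by simpa using hi), List.getD_replicate _ hi]
  · rw [List.getD_append_right _ _ _ _ (by simpa using hi1),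
      List.getD_append _ _ _ _ (by simp; omega), List.getD_replicate _ (by simp; omega)]
  · rw [List.getD_append_right _ _ _ _ (by simp; omega),
      List.getD_append_right _ _ _ _ (by simp; omega), List.getD_eq_getElem _ _ (by
        simp only [List.length_append, List.length_replicate] at hi2 ⊢; omega)]
    have hmem := List.getElem_mem (l := List.replicate m₄ 4 ++ (List.replicate m₅ 5 ++
      List.replicate m₆ 6)) (n := i - (List.replicate m₂ 2).length - (List.replicate m₃ 3).length)
      (by simp only [List.length_append, List.length_replicate] at hi2 ⊢; omega)
    simp only [List.mem_append, List.mem_replicate] at hmem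
    omega
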